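/- Let $\eta_\infty$ be the uniform probability distribution on the unit circle in $\mathbb{C}$, and for an integer $d \ge 1$ let $\eta_\infty^{*d}$ be its $d$-fold (additive) convolution, i.e. the law of $Z_1+\dots+Z_d$, where $Z_1,\dots,Z_d$ are independent random variables with distribution $\eta_\infty$. Then $z \mapsto \log|z|$ is integrable with respect to $\eta_\infty^{*d}$ for every $d \ge 1$, and the real numbers \[c_{\infty,d} = \int_{\mathbb{C}} \log|z| \, d\eta_\infty^{*d}(z)\] satisfy \[\lim_{d\to\infty}\Bigl(c_{\infty,d} - \frac{\log d}{2}\Bigr) = -\frac{\gamma}{2},\] where $\gamma$ is the Euler--Mascheroni constant. -/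

import Mathlib

open MeasureTheory Filter Topology

noncomputable section

/-- The uniform probability distribution `η_∞` on the unit circle in `ℂ`: the law of
`exp (i θ)` for an angle `θ` uniform on `(0, 2π]`. -/
def etaInfty : Measure ℂ :=
  (ProbabilityTheory.cond (volume : Measure ℝ) (Set.Ioc 0 (2 * Real.pi))).map
    (fun θ : ℝ => Complex.exp (θ * Complex.I))

/-- The `d`-fold additive convolution `μ^{*d}` of a measure on `ℂ`, with `μ^{*0} = δ_0`. -/
def convPow (μ : Measure ℂ) : ℕ → Measure ℂ
  | 0 => Measure.dirac 0
  | d + 1 => (convPow μ d).conv μ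

/-- The constant `c_{∞,d} = ∫ log |z| dη_∞^{*d}(z)`. -/
def cInfty (d : ℕ) : ℝ :=
  ∫ z : ℂ, Real.log ‖z‖ ∂(convPow etaInfty d)

end

/-! Put X = |Z₁ + ⋯ + Z_d|² / d, so that c_{∞,d} - (log d)/2 = E[log X] / 2. Averaging Frullani's
formula log x = ∫₀^∞ t⁻¹ (e^{-t} - e^{-tx}) dt gives E[log X] = ∫₀^∞ t⁻¹ (e^{-t} - L_d(t)) dt, where
L_d is the Laplace transform of X (`integrable_log_and_integral_log_eq_frullani`). As in the central
limit theorem, L_d(t) tends to 1/(1+t), the Laplace transform of the standard exponential law, whose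
logarithmic mean is Γ'(1) = -γ (`integral_frullani_inv_one_add`).

Convergence in law does not control log near 0 and ∞. Dominated convergence in t does, given bounds
uniform in d: 1 - L_d(t) ≤ Ct and L_d(t) ≤ C t^{-b} (`exists_laplace_convPow_bounds`). Since a
Gaussian is a Gaussian average of characters, L_d(t) is a Gaussian average of J₀(√t|η|/√d)^d.
Everything thus reduces to the expansion of J₀ at 0 and to |J₀(r)| ≤ (1+r²)^{-b}, where any small b
> 0 suffices. -/

/-! ### Frullani's integral for the logarithm -/

/-- A function of `t > 0` dominating `t⁻¹ |exp (-t) - L t|` when `1 - L t ≤ C t` and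
`L t ≤ C t ^ (-b)`. -/
noncomputable def frullaniBound (C b t : ℝ) : ℝ :=
  (Set.Ioc 0 1).indicator (fun _ => 1 + C) t +
    (Set.Ioi 1).indicator (fun t => Real.exp (-t) + C * t ^ (-1 - b)) t

lemma integrable_frullaniBound (C : ℝ) {b : ℝ} (hb : 0 < b) : Integrable (frullaniBound C b) := by
  refine Integrable.add ?_ ?_
  · rw [integrable_indicator_iff measurableSet_Ioc]
    exact integrableOn_const (by simp)
  · rw [integrable_indicator_iff measurableSet_Ioi]
    refine Integrable.add (integrableOn_exp_neg_Ioi 1) ?_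
    exact (integrableOn_Ioi_rpow_of_lt (by linarith) one_pos).const_mul C

/-- Here `a` stands for |e^{-t} - L| or for the mean of |e^{-t} - e^{-tX}|. For t ≤ 1 the linear
bounds on 1 - e^{-t} and 1 - L cancel t⁻¹; for t > 1 the decay of both terms is used. -/
lemma le_frullaniBound {C b t L a : ℝ} (ht : 0 < t) (h1 : 1 - L ≤ C * t)
    (h2 : L ≤ C * t ^ (-b)) (ha : a ≤ (1 - Real.exp (-t)) + (1 - L))
    (ha' : a ≤ Real.exp (-t) + L) : t⁻¹ * a ≤ frullaniBound C b t := by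
  rcases le_or_gt t 1 with h | h
  · have : frullaniBound C b t = 1 + C := by
      simp [frullaniBound, ht, h]
    rw [this, inv_mul_le_iff₀ ht]
    have := Real.add_one_le_exp (-t)
    nlinarith
  · have : frullaniBound C b t = Real.exp (-t) + C * t ^ (-1 - b) := by
      simp [frullaniBound, h]
    rw [this]
    have e : C * t ^ (-1 - b) = t⁻¹ * (C * t ^ (-b)) := by
      rw [sub_eq_add_neg, Real.rpow_add ht, Real.rpow_neg_one]; ring
    rw [e]
    calc t⁻¹ * a ≤ t⁻¹ * (Real.exp (-t) + C * t ^ (-b)) := by gcongr; linarith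
      _ = t⁻¹ * Real.exp (-t) + t⁻¹ * (C * t ^ (-b)) := by ring
      _ ≤ 1 * Real.exp (-t) + t⁻¹ * (C * t ^ (-b)) := by
          gcongr; exact inv_le_one_of_one_le₀ h.le
      _ = _ := by ring

lemma norm_inv_mul_exp_sub_le {C b t L : ℝ} (ht : 0 < t) (h1 : 1 - L ≤ C * t)
    (h2 : L ≤ C * t ^ (-b)) (h0 : 0 ≤ L) (hL : L ≤ 1) :
    ‖t⁻¹ * (Real.exp (-t) - L)‖ ≤ frullaniBound C b t := by
  rw [norm_mul, Real.norm_of_nonneg (inv_pos.2 ht).le]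
  have := Real.exp_pos (-t)
  have : Real.exp (-t) ≤ 1 := Real.exp_le_one_iff.2 (by linarith)
  refine le_frullaniBound ht h1 h2 ?_ ?_ <;> rw [Real.norm_eq_abs, abs_le'] <;>
    constructor <;> linarith

lemma mul_exp_neg_le_one (u : ℝ) : u * Real.exp (-u) ≤ 1 := by
  rw [Real.exp_neg, mul_inv_le_iff₀ (Real.exp_pos u)]
  linarith [Real.add_one_le_exp u]

lemma integrableOn_frullani_exp {x : ℝ} (hx : 0 < x) :
    IntegrableOn (fun t : ℝ => t⁻¹ * (Real.exp (-t) - Real.exp (-(t * x)))) (Set.Ioi 0) := by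
  refine Integrable.mono' ((integrable_frullaniBound (max x x⁻¹) one_pos).integrableOn)
    (by fun_prop) ?_
  filter_upwards [ae_restrict_mem measurableSet_Ioi] with t ht
  have ht : 0 < t := ht
  refine norm_inv_mul_exp_sub_le ht ?_ ?_ (Real.exp_pos _).le
    (Real.exp_le_one_iff.2 (by nlinarith))
  · have := Real.add_one_le_exp (-(t * x))
    have := mul_le_mul_of_nonneg_right (le_max_left x x⁻¹) ht.le
    nlinarith
  · have h := mul_exp_neg_le_one (t * x)
    have : Real.exp (-(t * x)) ≤ x⁻¹ * t ^ (-1 : ℝ) := by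
      rw [Real.rpow_neg_one, ← mul_inv, ← one_div, le_div_iff₀ (by positivity)]
      nlinarith
    refine this.trans ?_
    gcongr
    exact le_max_right _ _

lemma integral_frullani_exp {x : ℝ} (hx : 0 < x) :
    ∫ t in Set.Ioi (0 : ℝ), t⁻¹ * (Real.exp (-t) - Real.exp (-(t * x))) = Real.log x := by
  have hc : Continuous (fun t : ℝ => Real.exp (-t)) := by fun_prop
  have := Frullani.integral_Ioi_eq (f := fun t : ℝ => Real.exp (-t)) (a := 1) (b := x)
    (L := 1) (R := 0) (hc.locallyIntegrable.locallyIntegrableOn _) one_pos hx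
    (tendsto_nhdsWithin_of_tendsto_nhds (by simpa using hc.tendsto 0))
    (Real.tendsto_exp_neg_atTop_nhds_zero)
    (by simpa [mul_comm] using integrableOn_frullani_exp hx)
  simpa [mul_comm] using this

/-! ### Logarithmic moments from Laplace transforms -/

section

variable {Ω : Type*} [MeasurableSpace Ω] {μ : Measure Ω} [IsProbabilityMeasure μ] {X : Ω → ℝ}

lemma integrable_exp_neg_mul (hX : Measurable X) (h0 : ∀ ω, 0 ≤ X ω) {t : ℝ} (ht : 0 ≤ t) :
    Integrable (fun ω => Real.exp (-(t * X ω))) μ := by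
  refine Integrable.of_bound (C := 1) (by fun_prop) (ae_of_all _ fun ω => ?_)
  rw [Real.norm_of_nonneg (Real.exp_pos _).le]
  exact Real.exp_le_one_iff.2 (by have := mul_nonneg ht (h0 ω); linarith)

/-- The indicator of {X = 0} is at most e^{-tX}; let t → ∞. -/
lemma ae_pos_of_laplace_le (hX : Measurable X) (h0 : ∀ ω, 0 ≤ X ω) {C b : ℝ} (hb : 0 < b)
    (h2 : ∀ t > 0, ∫ ω, Real.exp (-(t * X ω)) ∂μ ≤ C * t ^ (-b)) : ∀ᵐ ω ∂μ, 0 < X ω := by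
  have hm : MeasurableSet {ω | X ω = 0} := hX (measurableSet_singleton 0)
  have key : ∀ t > 0, μ.real {ω | X ω = 0} ≤ C * t ^ (-b) := by
    intro t ht
    refine le_trans ?_ (h2 t ht)
    rw [← integral_indicator_one hm]
    refine integral_mono ((integrable_const (1 : ℝ)).indicator hm)
      (integrable_exp_neg_mul hX h0 ht.le) fun ω => ?_
    by_cases h : X ω = 0
    · simp [h]
    · simp [h, (Real.exp_pos _).le]
  have lim : Tendsto (fun t : ℝ => C * t ^ (-b)) atTop (𝓝 0) := by
    simpa using (tendsto_rpow_neg_atTop hb).const_mul C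
  have hle : μ.real {ω | X ω = 0} ≤ 0 :=
    ge_of_tendsto lim ((eventually_gt_atTop 0).mono key)
  have hz : μ {ω | X ω = 0} = 0 := by
    have := le_antisymm hle measureReal_nonneg
    rwa [measureReal_eq_zero_iff] at this
  have : ∀ᵐ ω ∂μ, ¬ X ω = 0 := by simpa [ae_iff] using hz
  filter_upwards [this] with ω h using lt_of_le_of_ne (h0 ω) (Ne.symm h)

/-- Fubini applied to the pointwise Frullani formula; the two Laplace bounds give absolute
integrability on the product. -/
lemma integrable_log_and_integral_log_eq_frullani (hX : Measurable X) (h0 : ∀ ω, 0 ≤ X ω)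
    {C b : ℝ} (hb : 0 < b)
    (h1 : ∀ t > 0, 1 - ∫ ω, Real.exp (-(t * X ω)) ∂μ ≤ C * t)
    (h2 : ∀ t > 0, ∫ ω, Real.exp (-(t * X ω)) ∂μ ≤ C * t ^ (-b)) :
    Integrable (fun ω => Real.log (X ω)) μ ∧
      ∫ ω, Real.log (X ω) ∂μ =
        ∫ t in Set.Ioi (0 : ℝ), t⁻¹ * (Real.exp (-t) - ∫ ω, Real.exp (-(t * X ω)) ∂μ) := by
  set ν : Measure ℝ := volume.restrict (Set.Ioi 0)
  set F : Ω × ℝ → ℝ := fun p => p.2⁻¹ * (Real.exp (-p.2) - Real.exp (-(p.2 * X p.1))) with hF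
  have hXm : Measurable fun p : Ω × ℝ => X p.1 := hX.comp measurable_fst
  have hFm : Measurable F := by fun_prop
  have hFi : ∀ t > 0, Integrable (fun ω => F (ω, t)) μ := fun t ht =>
    ((integrable_const (Real.exp (-t))).sub (integrable_exp_neg_mul hX h0 ht.le)).const_mul t⁻¹
  have hint : Integrable F (μ.prod ν) := by
    rw [integrable_prod_iff' hFm.aestronglyMeasurable]
    refine ⟨(ae_restrict_mem measurableSet_Ioi).mono fun t ht => hFi t ht, ?_⟩
    refine Integrable.mono' (integrable_frullaniBound C hb).integrableOn
      (hFm.norm.stronglyMeasurable.integral_prod_left'.aestronglyMeasurable) ?_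
    filter_upwards [ae_restrict_mem measurableSet_Ioi] with t ht
    have ht : 0 < t := ht
    have e1 : Real.exp (-t) ≤ 1 := Real.exp_le_one_iff.2 (by linarith)
    have e2 : ∀ ω, Real.exp (-(t * X ω)) ≤ 1 := fun ω =>
      Real.exp_le_one_iff.2 (by have := mul_nonneg ht.le (h0 ω); linarith)
    have hi := integrable_exp_neg_mul (μ := μ) hX h0 ht.le
    rw [Real.norm_of_nonneg (integral_nonneg fun _ => norm_nonneg _)]
    have : ∫ ω, ‖F (ω, t)‖ ∂μ = t⁻¹ * ∫ ω, |Real.exp (-t) - Real.exp (-(t * X ω))| ∂μ := by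
      rw [← integral_const_mul]
      simp [hF, abs_of_pos ht]
    rw [this]
    have ha : Integrable (fun ω => |Real.exp (-t) - Real.exp (-(t * X ω))|) μ :=
      ((integrable_const _).sub hi).abs
    refine le_frullaniBound ht (h1 t ht) (h2 t ht) ?_ ?_
    · have : (1 - Real.exp (-t)) + (1 - ∫ ω, Real.exp (-(t * X ω)) ∂μ) =
          ∫ ω, ((2 - Real.exp (-t)) - Real.exp (-(t * X ω))) ∂μ := by
        rw [integral_sub (integrable_const _) hi]; simp; ring
      rw [this]
      refine integral_mono ha ((integrable_const _).sub hi) fun ω => ?_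
      have := e2 ω
      simp only [abs_le']
      constructor <;> linarith
    · have : Real.exp (-t) + ∫ ω, Real.exp (-(t * X ω)) ∂μ =
          ∫ ω, (Real.exp (-t) + Real.exp (-(t * X ω))) ∂μ := by
        rw [integral_add (integrable_const _) hi]; simp
      rw [this]
      refine integral_mono ha ((integrable_const _).add hi) fun ω => ?_
      have := Real.exp_pos (-t)
      have := Real.exp_pos (-(t * X ω))
      simp only [abs_le']
      constructor <;> linarith
  have hlog : (fun ω => ∫ t, F (ω, t) ∂ν) =ᵐ[μ] fun ω => Real.log (X ω) := by
    filter_upwards [ae_pos_of_laplace_le hX h0 hb h2] with ω hω using integral_frullani_exp hω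
  refine ⟨hint.integral_prod_left.congr hlog, ?_⟩
  rw [← integral_congr_ae hlog, integral_integral_swap hint]
  refine setIntegral_congr_fun measurableSet_Ioi fun t ht => ?_
  simp only [hF]
  rw [integral_const_mul, integral_sub (integrable_const _)
    (integrable_exp_neg_mul hX h0 (le_of_lt ht))]
  simp

end

/-! ### The exponential law and Euler's constant -/

/-- The integral is Γ'(1), by differentiating Euler's integral under the integral sign. -/
lemma integral_exp_neg_mul_log :
    ∫ x in Set.Ioi (0 : ℝ), Real.exp (-x) * Real.log x = -Real.eulerMascheroniConstant := by
  have h := Complex.hasDerivAt_GammaIntegral (s := 1) (by simp)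
  have h' : HasDerivAt Complex.Gamma
      (∫ t : ℝ in Set.Ioi 0, (t : ℂ) ^ ((1 : ℂ) - 1) * (Real.log t * Real.exp (-t))) 1 := by
    refine h.congr_of_eventuallyEq ?_
    have : {s : ℂ | 0 < s.re} ∈ 𝓝 (1 : ℂ) :=
      (isOpen_lt continuous_const Complex.continuous_re).mem_nhds (by simp)
    filter_upwards [this] with s hs using Complex.Gamma_eq_integral hs
  have := h'.unique Complex.hasDerivAt_Gamma_one
  rw [← Complex.ofReal_inj, ← integral_complex_ofReal]
  push_cast
  rw [← this]
  refine setIntegral_congr_fun measurableSet_Ioi fun t ht => ?_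
  simp [mul_comm]

/-- The standard exponential law on `ℝ`. -/
noncomputable def stdExp : Measure ℝ :=
  (volume.restrict (Set.Ioi 0)).withDensity fun x => ENNReal.ofReal (Real.exp (-x))

lemma integral_stdExp (f : ℝ → ℝ) :
    ∫ x, f x ∂stdExp = ∫ x in Set.Ioi (0 : ℝ), Real.exp (-x) * f x := by
  rw [stdExp, integral_withDensity_eq_integral_toReal_smul (by fun_prop) (by simp)]
  simp [ENNReal.toReal_ofReal (Real.exp_pos _).le]

instance isProbabilityMeasure_stdExp : IsProbabilityMeasure stdExp := by
  constructor
  rw [stdExp, withDensity_apply _ MeasurableSet.univ, Measure.restrict_univ,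
    ← ofReal_integral_eq_lintegral_ofReal (integrableOn_exp_neg_Ioi 0)
      (ae_of_all _ fun _ => (Real.exp_pos _).le), integral_exp_neg_Ioi]
  simp

lemma integral_frullani_inv_one_add :
    ∫ t in Set.Ioi (0 : ℝ), t⁻¹ * (Real.exp (-t) - (1 + t)⁻¹) =
      -Real.eulerMascheroniConstant := by
  have hpos : ∀ᵐ x ∂stdExp, 0 < x :=
    (withDensity_absolutelyContinuous _ _).ae_le (ae_restrict_mem measurableSet_Ioi)
  have hae : ∀ t : ℝ, (fun x => Real.exp (-(t * |x|))) =ᵐ[stdExp] fun x => Real.exp (-(t * x)) := by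
    intro t
    filter_upwards [hpos] with x hx
    rw [abs_of_pos hx]
  have hL : ∀ t > 0, ∫ x, Real.exp (-(t * |x|)) ∂stdExp = (1 + t)⁻¹ := by
    intro t ht
    rw [integral_congr_ae (hae t), integral_stdExp]
    have := integral_exp_mul_Ioi (a := -(1 + t)) (by linarith) 0
    simp only [← Real.exp_add]
    simp only [mul_zero, Real.exp_zero, neg_div_neg_eq, one_div] at this
    rw [← this]
    congr with x
    ring_nf
  -- The absolute value supplies nonnegativity everywhere, the identity being positive only almost
  -- surely.
  have key := integrable_log_and_integral_log_eq_frullani (μ := stdExp) (X := fun x => |x|)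
    (C := 1) (b := 1) (by fun_prop) (fun _ => abs_nonneg _) one_pos
    (fun t ht => by
      rw [hL t ht, sub_le_iff_le_add, ← sub_le_iff_le_add', ← one_div,
        le_div_iff₀ (by positivity)]
      nlinarith [sq_nonneg t])
    (fun t ht => by
      rw [hL t ht, Real.rpow_neg_one, one_mul]
      gcongr; linarith)
  have e := key.2
  simp only [Real.log_abs] at e
  rw [integral_stdExp, integral_exp_neg_mul_log] at e
  rw [e]
  refine setIntegral_congr_fun measurableSet_Ioi fun t ht => ?_
  rw [hL t ht]

/-! ### Bounds for the Bessel function J₀ -/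

/-- The Bessel function `J₀`, as the average of `cos (r cos θ)`. -/
noncomputable def besselZero (r : ℝ) : ℝ :=
  (2 * Real.pi)⁻¹ * ∫ θ in (0 : ℝ)..2 * Real.pi, Real.cos (r * Real.cos θ)

lemma continuous_besselZero : Continuous besselZero := by
  unfold besselZero
  refine continuous_const.mul ?_
  exact intervalIntegral.continuous_parametric_intervalIntegral_of_continuous' (by fun_prop) _ _

lemma abs_besselZero_le_of_integral_le {r c : ℝ}
    (h : |∫ θ in (0 : ℝ)..2 * Real.pi, Real.cos (r * Real.cos θ)| ≤ 2 * Real.pi * c) :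
    |besselZero r| ≤ c := by
  have := Real.pi_pos
  rw [besselZero, abs_mul, abs_of_pos (by positivity), inv_mul_le_iff₀ (by positivity)]
  exact h

lemma abs_besselZero_le_one (r : ℝ) : |besselZero r| ≤ 1 := by
  refine abs_besselZero_le_of_integral_le ?_
  have := intervalIntegral.norm_integral_le_of_norm_le_const (a := 0) (b := 2 * Real.pi) (C := 1)
    (f := fun θ => Real.cos (r * Real.cos θ)) (fun θ _ => Real.abs_cos_le_one _)
  have hp := Real.pi_pos
  simpa [abs_of_pos hp] using this

lemma average_one_sub_sq (r : ℝ) :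
    (2 * Real.pi)⁻¹ * ∫ θ in (0 : ℝ)..2 * Real.pi, (1 - (r * Real.cos θ) ^ 2 / 2) =
      1 - r ^ 2 / 4 := by
  have : ∀ θ, 1 - (r * Real.cos θ) ^ 2 / 2 = 1 - r ^ 2 / 2 * Real.cos θ ^ 2 := fun θ => by ring
  simp_rw [this]
  rw [intervalIntegral.integral_sub (by simp)
    (Continuous.intervalIntegrable (by fun_prop) _ _), intervalIntegral.integral_const_mul,
    integral_cos_sq]
  have := Real.pi_pos
  simp
  field_simp
  ring

lemma one_sub_sq_div_le_besselZero (r : ℝ) : 1 - r ^ 2 / 4 ≤ besselZero r := by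
  rw [← average_one_sub_sq, besselZero]
  have := Real.pi_pos
  gcongr
  refine intervalIntegral.integral_mono (by positivity)
    (Continuous.intervalIntegrable (by fun_prop) _ _)
    (Continuous.intervalIntegrable (by fun_prop) _ _) fun θ => Real.one_sub_sq_div_two_le_cos

lemma abs_besselZero_sub_le {r : ℝ} (hr : |r| ≤ 1) :
    |besselZero r - (1 - r ^ 2 / 4)| ≤ r ^ 4 * (5 / 96) := by
  have hp := Real.pi_pos
  rw [← average_one_sub_sq, besselZero, ← mul_sub, ← intervalIntegral.integral_sub
    (Continuous.intervalIntegrable (by fun_prop) _ _)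
    (Continuous.intervalIntegrable (by fun_prop) _ _), abs_mul, abs_of_pos (by positivity),
    inv_mul_le_iff₀ (by positivity)]
  have := intervalIntegral.norm_integral_le_of_norm_le_const (a := 0) (b := 2 * Real.pi)
    (C := r ^ 4 * (5 / 96))
    (f := fun θ => Real.cos (r * Real.cos θ) - (1 - (r * Real.cos θ) ^ 2 / 2)) (fun θ _ => by
      have h1 : |r * Real.cos θ| ≤ |r| := by
        rw [abs_mul]
        exact mul_le_of_le_one_right (abs_nonneg _) (Real.abs_cos_le_one _)
      have := Real.cos_bound (h1.trans hr)
      have h2 : |r * Real.cos θ| ^ 4 ≤ |r| ^ 4 := by gcongr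
      rw [Even.pow_abs (by decide) r] at h2
      rw [Real.norm_eq_abs]
      linarith)
  rw [Real.norm_eq_abs, sub_zero, abs_of_pos (by positivity : 0 < 2 * Real.pi)] at this
  linarith

lemma integral_cos_mul_cos_eq_four_mul (r : ℝ) :
    ∫ θ in (0 : ℝ)..2 * Real.pi, Real.cos (r * Real.cos θ) =
      4 * ∫ θ in (0 : ℝ)..Real.pi / 2, Real.cos (r * Real.cos θ) := by
  set g : ℝ → ℝ := fun θ => Real.cos (r * Real.cos θ) with hg
  have hi : ∀ a b, IntervalIntegrable g volume a b := fun a b =>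
    Continuous.intervalIntegrable (by fun_prop) _ _
  have hper : Function.Periodic g Real.pi := fun θ => by simp [hg]
  have h1 : ∫ θ in (0 : ℝ)..2 * Real.pi, g θ = 2 * ∫ θ in (0 : ℝ)..Real.pi, g θ := by
    rw [← intervalIntegral.integral_add_adjacent_intervals (hi 0 Real.pi) (hi _ _)]
    have := hper.intervalIntegral_add_eq Real.pi 0
    rw [zero_add, ← two_mul] at this
    rw [this]; ring
  have h2 : ∫ θ in (0 : ℝ)..Real.pi, g θ = 2 * ∫ θ in (0 : ℝ)..Real.pi / 2, g θ := by
    rw [← intervalIntegral.integral_add_adjacent_intervals (hi 0 (Real.pi / 2)) (hi _ _)]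
    have : ∫ θ in (Real.pi / 2)..Real.pi, g θ = ∫ θ in (0 : ℝ)..Real.pi / 2, g (Real.pi - θ) := by
      rw [intervalIntegral.integral_comp_sub_left g Real.pi]
      congr 1 <;> ring
    rw [this]
    simp only [hg, Real.cos_pi_sub, mul_neg, Real.cos_neg]
    ring
  change ∫ θ in (0 : ℝ)..2 * Real.pi, g θ = 4 * ∫ θ in (0 : ℝ)..Real.pi / 2, g θ
  rw [h1, h2]; ring

/-- Integration by parts against 1/sin θ; the cutoff ε avoids the stationary point θ = 0 of the
phase. -/
lemma abs_integral_cos_mul_cos_le {r ε : ℝ} (hr : 0 < r) (hε : 0 < ε) (hε' : ε ≤ Real.pi / 2) :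
    |∫ θ in ε..Real.pi / 2, Real.cos (r * Real.cos θ)| ≤ Real.pi / (r * ε) := by
  have hs : ∀ θ ∈ Set.uIcc ε (Real.pi / 2), 0 < Real.sin θ := by
    intro θ hθ
    rw [Set.uIcc_of_le hε'] at hθ
    exact Real.sin_pos_of_pos_of_lt_pi (hε.trans_le hθ.1) (by linarith [hθ.2, Real.pi_pos])
  have hu : ∀ θ ∈ Set.uIcc ε (Real.pi / 2),
      HasDerivAt (fun θ => (Real.sin θ)⁻¹) (-Real.cos θ / Real.sin θ ^ 2) θ := fun θ hθ =>
    (Real.hasDerivAt_sin θ).inv (hs θ hθ).ne'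
  have hv : ∀ θ ∈ Set.uIcc ε (Real.pi / 2), HasDerivAt (fun θ => Real.sin (r * Real.cos θ))
      (Real.cos (r * Real.cos θ) * (r * -Real.sin θ)) θ := fun θ _ =>
    ((Real.hasDerivAt_cos θ).const_mul r).sin
  have hui : IntervalIntegrable (fun θ => -Real.cos θ / Real.sin θ ^ 2) volume ε (Real.pi / 2) :=
    ContinuousOn.intervalIntegrable
      (ContinuousOn.div (by fun_prop) (by fun_prop) fun θ hθ => (pow_pos (hs θ hθ) 2).ne')
  have hvi : IntervalIntegrable (fun θ => Real.cos (r * Real.cos θ) * (r * -Real.sin θ)) volume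
      ε (Real.pi / 2) := Continuous.intervalIntegrable (by fun_prop) _ _
  have parts := intervalIntegral.integral_mul_deriv_eq_deriv_mul hu hv hui hvi
  have e1 : ∫ θ in ε..Real.pi / 2, (Real.sin θ)⁻¹ *
      (Real.cos (r * Real.cos θ) * (r * -Real.sin θ)) =
      -r * ∫ θ in ε..Real.pi / 2, Real.cos (r * Real.cos θ) := by
    rw [← intervalIntegral.integral_const_mul]
    refine intervalIntegral.integral_congr fun θ hθ => ?_
    have := (hs θ hθ).ne'
    field_simp
  -- As 1/sin is decreasing on this interval, the integral of |(1/sin)'| telescopes.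
  have hfin := intervalIntegral.norm_integral_le_of_norm_le (μ := volume) hε'
    (f := fun θ => -Real.cos θ / Real.sin θ ^ 2 * Real.sin (r * Real.cos θ))
    (g := fun θ => -(-Real.cos θ / Real.sin θ ^ 2))
    (ae_of_all _ fun θ hθ => by
      have hc : 0 ≤ Real.cos θ := Real.cos_nonneg_of_neg_pi_div_two_le_of_le
        (by linarith [hθ.1, Real.pi_pos]) hθ.2
      rw [norm_mul, norm_div, norm_neg, Real.norm_of_nonneg hc,
        Real.norm_of_nonneg (sq_nonneg _), neg_div, neg_neg]
      exact mul_le_of_le_one_right (by positivity) (Real.abs_sin_le_one _)) hui.neg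
  rw [intervalIntegral.integral_neg, intervalIntegral.integral_eq_sub_of_hasDerivAt hu hui] at hfin
  have hsε : 0 < Real.sin ε := hs ε Set.left_mem_uIcc
  have hsin : 2 / Real.pi * ε ≤ Real.sin ε := Real.mul_le_sin hε.le hε'
  have hinv : (Real.sin ε)⁻¹ ≤ Real.pi / (2 * ε) := by
    have hp := Real.pi_pos
    rw [inv_le_comm₀ hsε (by positivity), inv_div]
    calc _ = 2 / Real.pi * ε := by ring
      _ ≤ _ := hsin
  have hb : |(Real.sin ε)⁻¹ * Real.sin (r * Real.cos ε)| ≤ (Real.sin ε)⁻¹ := by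
    rw [abs_mul, abs_of_pos (inv_pos.2 hsε)]
    exact mul_le_of_le_one_right (inv_pos.2 hsε).le (Real.abs_sin_le_one _)
  rw [e1] at parts
  simp only [Real.cos_pi_div_two, mul_zero, Real.sin_zero, zero_sub, Real.sin_pi_div_two,
    inv_one, Real.norm_eq_abs] at parts hfin
  have : r * |∫ θ in ε..Real.pi / 2, Real.cos (r * Real.cos θ)| ≤ Real.pi / ε := by
    have h3 : |-r * ∫ θ in ε..Real.pi / 2, Real.cos (r * Real.cos θ)| ≤ 2 * (Real.sin ε)⁻¹ := by
      rw [parts, abs_le]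
      have := abs_le.1 hb
      have := abs_le.1 hfin
      constructor <;> linarith
    rw [abs_mul, abs_neg, abs_of_pos hr] at h3
    calc _ ≤ _ := h3
      _ ≤ 2 * (Real.pi / (2 * ε)) := by gcongr
      _ = _ := by field_simp
  rw [mul_comm, ← le_div_iff₀ hr] at this
  rwa [div_div, mul_comm ε r] at this

lemma abs_besselZero_le_div_sqrt {r : ℝ} (hr : 1 ≤ r) : |besselZero r| ≤ 4 / √r := by
  have hr0 : 0 < r := by linarith
  have hs : 0 < √r := Real.sqrt_pos.2 hr0
  have hs1 : 1 ≤ √r := Real.one_le_sqrt.2 hr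
  have hp := Real.pi_gt_three
  -- This choice balances the trivial bound ε on [0, ε] against π/(rε) on the rest.
  set ε := (√r)⁻¹ with hεd
  have hε : 0 < ε := inv_pos.2 hs
  have hε1 : ε ≤ 1 := inv_le_one_of_one_le₀ hs1
  have hi : ∀ a b, IntervalIntegrable (fun θ => Real.cos (r * Real.cos θ)) volume a b :=
    fun a b => Continuous.intervalIntegrable (by fun_prop) _ _
  refine abs_besselZero_le_of_integral_le ?_
  rw [integral_cos_mul_cos_eq_four_mul,
    ← intervalIntegral.integral_add_adjacent_intervals (hi 0 ε) (hi _ _)]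
  have h1 := intervalIntegral.norm_integral_le_of_norm_le_const (a := 0) (b := ε) (C := 1)
    (f := fun θ => Real.cos (r * Real.cos θ)) (fun θ _ => Real.abs_cos_le_one _)
  have h2 := abs_integral_cos_mul_cos_le hr0 hε (by linarith)
  have h3 : Real.pi / (r * ε) = Real.pi * ε := by
    rw [hεd]
    have := Real.mul_self_sqrt hr0.le
    field_simp
    nlinarith
  rw [h3] at h2
  rw [Real.norm_eq_abs, sub_zero, abs_of_pos hε, one_mul] at h1
  rw [abs_mul, abs_of_pos (by norm_num : (0 : ℝ) < 4)]
  have h4 := abs_add_le (∫ θ in (0 : ℝ)..ε, Real.cos (r * Real.cos θ))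
    (∫ θ in ε..Real.pi / 2, Real.cos (r * Real.cos θ))
  have h5 : 4 / √r = 4 * ε := by rw [hεd]; rfl
  rw [h5]
  nlinarith

/-- Averaging cos 2x ≥ 4σ cos x - 3, which is 2(σ - cos x)² ≥ 0 for σ = ±1. Hence |J₀(r)| close to 1
forces J₀(2r) close to 1. -/
lemma one_sub_besselZero_two_mul_le (r : ℝ) :
    1 - besselZero (2 * r) ≤ 4 * (1 - |besselZero r|) := by
  have hp := Real.pi_pos
  have hi : ∀ s : ℝ, IntervalIntegrable (fun θ => Real.cos (s * Real.cos θ)) volume 0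
    (2 * Real.pi) := fun s => Continuous.intervalIntegrable (by fun_prop) _ _
  have key : ∀ σ : ℝ, |σ| ≤ 1 → σ ^ 2 = 1 → 1 - besselZero (2 * r) ≤ 4 * (1 - σ * besselZero r) := by
    intro σ hσ hσ2
    have h1 : ∫ θ in (0 : ℝ)..2 * Real.pi, (4 * σ * Real.cos (r * Real.cos θ) - 3) ≤
        ∫ θ in (0 : ℝ)..2 * Real.pi, Real.cos (2 * r * Real.cos θ) := by
      refine intervalIntegral.integral_mono (by positivity)
        (((hi r).const_mul _).sub (by simp)) (hi _) fun θ => ?_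
      simp only
      rw [mul_assoc 2, Real.cos_two_mul]
      nlinarith [sq_nonneg (σ - Real.cos (r * Real.cos θ))]
    rw [intervalIntegral.integral_sub ((hi r).const_mul _) (by simp),
      intervalIntegral.integral_const_mul, intervalIntegral.integral_const] at h1
    have h2 := mul_le_mul_of_nonneg_left h1 (by positivity : 0 ≤ (2 * Real.pi)⁻¹)
    have h3 : (2 * Real.pi)⁻¹ * ((2 * Real.pi - 0) • (3 : ℝ)) = 3 := by
      rw [sub_zero, smul_eq_mul]; field_simp
    rw [mul_sub, h3] at h2
    unfold besselZero
    linarith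
  rcases abs_cases (besselZero r) with h | h
  · rw [h.1]; simpa using key 1 (by simp) (by simp)
  · rw [h.1]; simpa using key (-1) (by simp) (by simp)

lemma abs_besselZero_le_of_one_le {r : ℝ} (hr : 1 ≤ r) : |besselZero r| ≤ 1 - 1 / 8192 := by
  -- Six doublings reach 64r ≥ 64, where 4/√(64r) ≤ 1/2. Going back costs 4⁶, leaving the gap
  -- (1/2)/4096 = 1/8192.
  have h6 : besselZero (2 * (2 * (2 * (2 * (2 * (2 * r)))))) ≤ 1 / 2 := by
    refine (le_abs_self _).trans ((abs_besselZero_le_div_sqrt (by linarith)).trans ?_)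
    rw [div_le_div_iff₀ (Real.sqrt_pos.2 (by linarith)) two_pos, one_mul]
    exact Real.le_sqrt_of_sq_le (by linarith)
  have h := fun s => one_sub_besselZero_two_mul_le s
  have h' := fun s => le_abs_self (besselZero s)
  linarith [h r, h (2 * r), h (2 * (2 * r)), h (2 * (2 * (2 * r))), h (2 * (2 * (2 * (2 * r)))),
    h (2 * (2 * (2 * (2 * (2 * r))))), h' (2 * r), h' (2 * (2 * r)), h' (2 * (2 * (2 * r))),
    h' (2 * (2 * (2 * (2 * r)))), h' (2 * (2 * (2 * (2 * (2 * r)))))]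

lemma exists_abs_besselZero_le_rpow :
    ∃ b : ℝ, 0 < b ∧ b < 1 ∧ ∀ r : ℝ, 0 ≤ r → |besselZero r| ≤ (1 + r ^ 2) ^ (-b) := by
  -- The middle range 1 ≤ r ≤ 256 dictates b: there log(1 + r²) ≤ 17, and 17b ≤ 1/8192 is needed.
  refine ⟨1 / 200000, by norm_num, by norm_num, fun r hr => ?_⟩
  rw [Real.rpow_def_of_pos (by positivity)]
  rcases le_total r 1 with h1 | h1
  · have h := abs_le.1 (abs_besselZero_sub_le (by rwa [abs_of_nonneg hr]))
    have h2 : r ^ 2 ≤ 1 := pow_le_one₀ hr h1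
    have h4 : r ^ 4 ≤ r ^ 2 := pow_le_pow_of_le_one hr h1 (by norm_num)
    have hb : |besselZero r| ≤ 1 - r ^ 2 / 8 := by
      rw [abs_le]; constructor <;> linarith
    have hlog : Real.log (1 + r ^ 2) ≤ r ^ 2 := by
      have := Real.log_le_sub_one_of_pos (by positivity : 0 < 1 + r ^ 2)
      linarith
    refine hb.trans ((Real.one_sub_le_exp_neg _).trans (Real.exp_le_exp.2 ?_))
    nlinarith [sq_nonneg r]
  rcases le_total r 256 with h2 | h2
  · have hlog : Real.log (1 + r ^ 2) ≤ 17 := by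
      have : Real.log (1 + r ^ 2) ≤ Real.log (2 ^ 17) :=
        Real.log_le_log (by positivity) (by nlinarith)
      rw [Real.log_pow] at this
      have := Real.log_two_lt_d9
      push_cast at *
      linarith
    refine (abs_besselZero_le_of_one_le h1).trans
      ((Real.one_sub_le_exp_neg _).trans (Real.exp_le_exp.2 ?_))
    linarith
  · have hr0 : 0 < r := by linarith
    refine (abs_besselZero_le_div_sqrt h1).trans ?_
    rw [← Real.exp_log (by positivity : 0 < 4 / √r), Real.exp_le_exp,
      Real.log_div (by norm_num) (Real.sqrt_pos.2 hr0).ne', Real.log_sqrt hr0.le]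
    have e1 : Real.log (1 + r ^ 2) ≤ 4 * Real.log r := by
      have : Real.log (1 + r ^ 2) ≤ Real.log (r ^ 4) :=
        Real.log_le_log (by positivity) (by nlinarith [sq_nonneg (r ^ 2 - 2)])
      rw [Real.log_pow] at this
      exact_mod_cast this
    have e2 : 4 * Real.log 4 ≤ Real.log r := by
      have : Real.log (4 ^ 4) ≤ Real.log r := Real.log_le_log (by norm_num) (by linarith)
      rw [Real.log_pow] at this
      exact_mod_cast this
    have e3 : 0 ≤ Real.log r := Real.log_nonneg h1
    linarith

/-- By the expansion at 0, d(J₀(x/√d) - 1) → -x²/4, and (1 + c_d/d)^d → e^c when c_d → c. -/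
lemma tendsto_besselZero_pow (x : ℝ) :
    Tendsto (fun d : ℕ => besselZero (x / √d) ^ d) atTop (𝓝 (Real.exp (-(x ^ 2 / 4)))) := by
  have key : Tendsto (fun d : ℕ => (d : ℝ) * (besselZero (x / √d) - 1)) atTop
      (𝓝 (-(x ^ 2 / 4))) := by
    rw [tendsto_iff_norm_sub_tendsto_zero]
    have lim : Tendsto (fun d : ℕ => x ^ 4 * (5 / 96) / (d : ℝ)) atTop (𝓝 0) :=
      tendsto_const_div_atTop_nhds_zero_nat _
    refine squeeze_zero' (Eventually.of_forall fun _ => norm_nonneg _) ?_ lim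
    filter_upwards [eventually_gt_atTop 0,
      (tendsto_natCast_atTop_atTop (R := ℝ)).eventually_ge_atTop (x ^ 2)] with d hd hdx
    have hd0 : (0 : ℝ) < d := by exact_mod_cast hd
    have hsq : (x / √d) ^ 2 = x ^ 2 / d := by rw [div_pow, Real.sq_sqrt hd0.le]
    have h := abs_besselZero_sub_le (r := x / √d) (by
      rw [← sq_le_one_iff_abs_le_one, hsq]
      exact div_le_one_of_le₀ hdx hd0.le)
    have e : (d : ℝ) * (besselZero (x / √d) - 1) - -(x ^ 2 / 4) =
        d * (besselZero (x / √d) - (1 - (x / √d) ^ 2 / 4)) := by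
      rw [hsq]; field_simp; ring
    rw [e, norm_mul, Real.norm_of_nonneg hd0.le, Real.norm_eq_abs]
    calc _ ≤ d * ((x / √d) ^ 4 * (5 / 96)) := by gcongr
      _ = _ := by
        rw [show (x / √d) ^ 4 = ((x / √d) ^ 2) ^ 2 by ring, hsq]; field_simp
  refine (Real.tendsto_one_add_pow_exp_of_tendsto key).congr fun d => by ring

/-! ### Characteristic functions of the convolution powers -/

open scoped RealInnerProductSpace

lemma inner_exp_mul_I (θ ρ α : ℝ) :
    ⟪Complex.exp (θ * Complex.I), ρ * Complex.exp (α * Complex.I)⟫ =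
      ρ * Real.cos (θ - α) := by
  rw [Complex.inner, Real.cos_sub]
  simp [Complex.exp_mul_I, ← Complex.ofReal_cos, ← Complex.ofReal_sin]
  ring

lemma integral_etaInfty {f : ℂ → ℂ} (hf : Continuous f) :
    ∫ z, f z ∂etaInfty =
      (2 * Real.pi : ℝ)⁻¹ • ∫ θ in (0 : ℝ)..2 * Real.pi, f (Complex.exp (θ * Complex.I)) := by
  have hp := Real.pi_pos
  rw [etaInfty, integral_map (by fun_prop) hf.aestronglyMeasurable, ProbabilityTheory.cond,
    integral_smul_measure, intervalIntegral.integral_of_le (by positivity)]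
  simp [ENNReal.toReal_ofReal hp.le]

instance isProbabilityMeasure_etaInfty : IsProbabilityMeasure etaInfty := by
  have hp := Real.pi_pos
  have : IsProbabilityMeasure (ProbabilityTheory.cond (volume : Measure ℝ)
      (Set.Ioc 0 (2 * Real.pi))) :=
    ProbabilityTheory.cond_isProbabilityMeasure_of_finite (by simp [hp])
      (by simp [ENNReal.mul_eq_top])
  exact Measure.isProbabilityMeasure_map (by fun_prop)

instance isProbabilityMeasure_convPow (μ : Measure ℂ) [IsProbabilityMeasure μ] (d : ℕ) :
    IsProbabilityMeasure (convPow μ d) := by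
  induction d with
  | zero => unfold convPow; infer_instance
  | succ d ih => unfold convPow; infer_instance

lemma charFun_convPow (μ : Measure ℂ) [IsProbabilityMeasure μ] (d : ℕ) (ξ : ℂ) :
    charFun (convPow μ d) ξ = charFun μ ξ ^ d := by
  induction d with
  | zero => simp [convPow]
  | succ d ih => rw [convPow, charFun_conv, ih, pow_succ]

/-- Periodicity removes the phase α, and θ ↦ θ + π flips the sign of the imaginary part, which
therefore integrates to 0. -/
lemma integral_cexp_mul_cos (ρ α : ℝ) :
    ∫ θ in (0 : ℝ)..2 * Real.pi, Complex.exp ((ρ * Real.cos (θ - α) : ℝ) * Complex.I) =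
      ((∫ θ in (0 : ℝ)..2 * Real.pi, Real.cos (ρ * Real.cos θ) : ℝ) : ℂ) := by
  set g : ℝ → ℂ := fun θ => Complex.exp ((ρ * Real.cos θ : ℝ) * Complex.I) with hg
  have hper : Function.Periodic g (2 * Real.pi) := fun θ => by
    simp only [hg, Real.cos_add_two_pi]
  have h1 : ∫ θ in (0 : ℝ)..2 * Real.pi, g (θ - α) = ∫ θ in (0 : ℝ)..2 * Real.pi, g θ := by
    rw [intervalIntegral.integral_comp_sub_right g α]
    have := hper.intervalIntegral_add_eq (0 - α) 0
    rw [zero_add] at this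
    rw [← this]
    congr 1; ring
  have hs : ∫ θ in (0 : ℝ)..2 * Real.pi, Real.sin (ρ * Real.cos θ) = 0 := by
    set s : ℝ → ℝ := fun θ => Real.sin (ρ * Real.cos θ) with hsd
    have hsper : Function.Periodic s (2 * Real.pi) := fun θ => by simp [hsd]
    have h2 : ∫ θ in (0 : ℝ)..2 * Real.pi, s (θ + Real.pi) = ∫ θ in (0 : ℝ)..2 * Real.pi, s θ := by
      rw [intervalIntegral.integral_comp_add_right s Real.pi]
      have := hsper.intervalIntegral_add_eq (0 + Real.pi) 0
      rw [zero_add (2 * Real.pi)] at this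
      rw [← this]
      congr 1; ring
    have h3 : ∀ θ, s (θ + Real.pi) = -s θ := fun θ => by simp [hsd]
    simp_rw [h3, intervalIntegral.integral_neg] at h2
    linarith
  change ∫ θ in (0 : ℝ)..2 * Real.pi, g (θ - α) = _
  rw [h1]
  have h4 : ∀ θ, g θ = (Real.cos (ρ * Real.cos θ) : ℂ) + (Real.sin (ρ * Real.cos θ) : ℂ) *
      Complex.I := fun θ => by
    simp only [hg]
    rw [Complex.exp_mul_I, Complex.ofReal_cos (ρ * Real.cos θ), Complex.ofReal_sin (ρ * Real.cos θ)]
  simp_rw [h4]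
  rw [intervalIntegral.integral_add (Continuous.intervalIntegrable (by fun_prop) _ _)
    (Continuous.intervalIntegrable (by fun_prop) _ _), intervalIntegral.integral_mul_const,
    intervalIntegral.integral_ofReal, intervalIntegral.integral_ofReal, hs]
  simp

lemma charFun_etaInfty (ξ : ℂ) : charFun etaInfty ξ = (besselZero ‖ξ‖ : ℂ) := by
  rw [charFun_apply, integral_etaInfty (by fun_prop)]
  have h : ∀ θ : ℝ, ⟪Complex.exp (θ * Complex.I), ξ⟫ = ‖ξ‖ * Real.cos (θ - ξ.arg) := fun θ => by
    rw [← inner_exp_mul_I, Complex.norm_mul_exp_arg_mul_I]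
  simp_rw [h, integral_cexp_mul_cos, besselZero]
  simp

/-! ### The Laplace transform as a Gaussian average -/

lemma integrable_exp_neg_mul_sq_norm {a : ℝ} (ha : 0 < a) :
    Integrable (fun η : ℂ => Real.exp (-(a * ‖η‖ ^ 2))) := by
  have := (GaussianFourier.integrable_cexp_neg_mul_sq_norm_add (V := ℂ) (b := (a : ℂ))
    (by simpa using ha) 0 0).norm
  refine this.congr (ae_of_all _ fun η => ?_)
  simp only [Complex.norm_exp]
  congr 1
  simp [← Complex.ofReal_pow]

lemma integral_exp_neg_sq {a : ℝ} (ha : 0 < a) :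
    ∫ η : ℂ, Real.exp (-(a * ‖η‖ ^ 2)) = Real.pi / a := by
  have := GaussianFourier.integral_rexp_neg_mul_sq_norm (V := ℂ) ha
  simpa using this

/-- Fourier transform of a Gaussian. Placing √t in the frequency keeps the weight independent of t,
as the later limits and bounds require. -/
lemma exp_neg_mul_sq_norm_eq_integral {t : ℝ} (ht : 0 ≤ t) (z : ℂ) :
    (Real.exp (-(t * ‖z‖ ^ 2)) : ℂ) = (4 * Real.pi : ℂ)⁻¹ *
      ∫ η : ℂ, (Real.exp (-(1 / 4 * ‖η‖ ^ 2)) : ℂ) * Complex.exp (⟪z, √t • η⟫ * Complex.I) := by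
  have h := GaussianFourier.integral_cexp_neg_mul_sq_norm_add (V := ℂ) (b := 1 / 4)
    (by norm_num) Complex.I (√t • z)
  have e : ∀ η : ℂ, Complex.exp (-(1 / 4) * ‖η‖ ^ 2 + Complex.I * ⟪√t • z, η⟫) =
      (Real.exp (-(1 / 4 * ‖η‖ ^ 2)) : ℂ) * Complex.exp (⟪z, √t • η⟫ * Complex.I) := fun η => by
    rw [Complex.exp_add, Complex.ofReal_exp, real_inner_smul_left, real_inner_smul_right]
    push_cast
    ring_nf
  simp_rw [e] at h
  have hn : ((‖√t • z‖ : ℝ) : ℂ) ^ 2 = (t : ℂ) * ‖z‖ ^ 2 := by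
    rw [norm_smul, ← Complex.ofReal_pow, mul_pow, Real.norm_of_nonneg (Real.sqrt_nonneg t),
      Real.sq_sqrt ht]
    push_cast; ring
  rw [h, hn]
  have hp : (Real.pi : ℂ) ≠ 0 := by exact_mod_cast Real.pi_pos.ne'
  simp only [Complex.finrank_real_complex, Complex.I_sq]
  push_cast
  rw [div_self two_ne_zero, Complex.cpow_one]
  field_simp

lemma integral_exp_neg_mul_sq_norm_eq_charFun (μ : Measure ℂ) [IsProbabilityMeasure μ] {t : ℝ}
    (ht : 0 ≤ t) : ((∫ z, Real.exp (-(t * ‖z‖ ^ 2)) ∂μ : ℝ) : ℂ) = (4 * Real.pi : ℂ)⁻¹ *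
      ∫ η : ℂ, (Real.exp (-(1 / 4 * ‖η‖ ^ 2)) : ℂ) * charFun μ (√t • η) := by
  rw [← integral_complex_ofReal]
  simp_rw [exp_neg_mul_sq_norm_eq_integral ht]
  rw [integral_const_mul, integral_integral_swap]
  · simp_rw [integral_const_mul, charFun_apply]
  · have h : Integrable (fun p : ℂ × ℂ => Real.exp (-(1 / 4 * ‖p.2‖ ^ 2))) (μ.prod volume) :=
      (integrable_exp_neg_mul_sq_norm (by norm_num : (0 : ℝ) < 1 / 4)).comp_snd μ
    refine h.mono' (Continuous.aestronglyMeasurable (by fun_prop)) (ae_of_all _ fun p => ?_)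
    simp only [Function.uncurry]
    rw [norm_mul, Complex.norm_exp_ofReal_mul_I, mul_one, Complex.norm_real,
      Real.norm_of_nonneg (Real.exp_pos _).le]

lemma integral_exp_neg_mul_sq_norm_convPow (d : ℕ) {t : ℝ} (ht : 0 ≤ t) :
    ∫ z, Real.exp (-(t * ‖z‖ ^ 2)) ∂(convPow etaInfty d) = (4 * Real.pi)⁻¹ *
      ∫ η : ℂ, Real.exp (-(1 / 4 * ‖η‖ ^ 2)) * besselZero (√t * ‖η‖) ^ d := by
  have h := integral_exp_neg_mul_sq_norm_eq_charFun (convPow etaInfty d) ht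
  have e : ∀ η : ℂ, (Real.exp (-(1 / 4 * ‖η‖ ^ 2)) : ℂ) * charFun (convPow etaInfty d) (√t • η) =
      ((Real.exp (-(1 / 4 * ‖η‖ ^ 2)) * besselZero (√t * ‖η‖) ^ d : ℝ) : ℂ) := fun η => by
    rw [charFun_convPow, charFun_etaInfty, norm_smul, Real.norm_of_nonneg (Real.sqrt_nonneg t)]
    push_cast; rfl
  simp_rw [e] at h
  rw [integral_complex_ofReal] at h
  exact_mod_cast h

/-- The Laplace transform of the law of `|Z₁ + ⋯ + Z_d|² / d`, as a Gaussian average. -/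
lemma laplace_convPow {d : ℕ} {t : ℝ} (ht : 0 ≤ t) :
    ∫ z, Real.exp (-(t * (‖z‖ ^ 2 / d))) ∂(convPow etaInfty d) = (4 * Real.pi)⁻¹ *
      ∫ η : ℂ, Real.exp (-(1 / 4 * ‖η‖ ^ 2)) * besselZero (√t * ‖η‖ / √d) ^ d := by
  have e1 : ∀ n : ℝ, t * (n ^ 2 / d) = t / d * n ^ 2 := fun n => by ring
  have e2 : ∀ n : ℝ, √t * n / √d = √(t / d) * n := fun n => by rw [Real.sqrt_div ht]; ring
  simp_rw [e1, e2]
  exact integral_exp_neg_mul_sq_norm_convPow d (by positivity)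

lemma integrable_gaussian_mul_besselZero (d : ℕ) (s u : ℝ) :
    Integrable (fun η : ℂ => Real.exp (-(1 / 4 * ‖η‖ ^ 2)) * besselZero (s * ‖η‖ / u) ^ d) := by
  have hc := continuous_besselZero
  refine (integrable_exp_neg_mul_sq_norm (by norm_num : (0 : ℝ) < 1 / 4)).mono'
    (Continuous.aestronglyMeasurable (by fun_prop)) (ae_of_all _ fun η => ?_)
  rw [norm_mul, norm_pow, Real.norm_of_nonneg (Real.exp_pos _).le]
  exact mul_le_of_le_one_right (Real.exp_pos _).le
    (pow_le_one₀ (norm_nonneg _) (abs_besselZero_le_one _))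

/-! ### Bounds uniform in d, and the limit of the Laplace transforms -/

/-- Bernoulli's inequality, valid because J₀ - 1 ≥ -2, combined with J₀(r) ≥ 1 - r²/4. -/
lemma one_sub_besselZero_pow_le {d : ℕ} (hd : 1 ≤ d) (x : ℝ) :
    1 - besselZero (x / √d) ^ d ≤ x ^ 2 / 4 := by
  have hd0 : (0 : ℝ) < d := by exact_mod_cast hd
  have h1 := abs_le.1 (abs_besselZero_le_one (x / √d))
  have h2 := one_add_mul_le_pow (a := besselZero (x / √d) - 1) (by linarith) d
  have h3 := one_sub_sq_div_le_besselZero (x / √d)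
  rw [div_pow, Real.sq_sqrt hd0.le] at h3
  have h4 : (d : ℝ) * (1 - besselZero (x / √d)) ≤ d * (x ^ 2 / d / 4) := by gcongr; linarith
  have h5 : (d : ℝ) * (x ^ 2 / d / 4) = x ^ 2 / 4 := by field_simp
  rw [add_sub_cancel] at h2
  linarith

lemma sq_mul_gaussian_le (n : ℝ) :
    Real.exp (-(1 / 4 * n ^ 2)) * n ^ 2 ≤ 8 * Real.exp (-(1 / 8 * n ^ 2)) := by
  have h := mul_exp_neg_le_one (1 / 8 * n ^ 2)
  have e : Real.exp (-(1 / 4 * n ^ 2)) =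
      Real.exp (-(1 / 8 * n ^ 2)) * Real.exp (-(1 / 8 * n ^ 2)) := by
    rw [← Real.exp_add]; ring_nf
  rw [e]
  nlinarith [Real.exp_pos (-(1 / 8 * n ^ 2))]

lemma one_sub_laplace_convPow_le {d : ℕ} (hd : 1 ≤ d) {t : ℝ} (ht : 0 ≤ t) :
    1 - ∫ z, Real.exp (-(t * (‖z‖ ^ 2 / d))) ∂(convPow etaInfty d) ≤ 4 * t := by
  have hp := Real.pi_pos
  have hg := integrable_exp_neg_mul_sq_norm (by norm_num : (0 : ℝ) < 1 / 4)
  have h1 : (1 : ℝ) = (4 * Real.pi)⁻¹ * ∫ η : ℂ, Real.exp (-(1 / 4 * ‖η‖ ^ 2)) := by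
    rw [integral_exp_neg_sq (by norm_num)]; field_simp
  rw [laplace_convPow ht]
  nth_rw 1 [h1]
  rw [← mul_sub, ← integral_sub hg (integrable_gaussian_mul_besselZero d _ _)]
  -- The integrand is at most (t|η|²/4) e^{-|η|²/4}; trading |η|² for a wider Gaussian costs a
  -- factor 8, hence 2t.
  have h2 : ∫ η : ℂ, (Real.exp (-(1 / 4 * ‖η‖ ^ 2)) -
      Real.exp (-(1 / 4 * ‖η‖ ^ 2)) * besselZero (√t * ‖η‖ / √d) ^ d) ≤
      ∫ η : ℂ, 2 * t * Real.exp (-(1 / 8 * ‖η‖ ^ 2)) := by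
    refine integral_mono (hg.sub (integrable_gaussian_mul_besselZero d _ _))
      ((integrable_exp_neg_mul_sq_norm (by norm_num)).const_mul _) fun η => ?_
    have h3 := one_sub_besselZero_pow_le hd (√t * ‖η‖)
    rw [mul_pow, Real.sq_sqrt ht] at h3
    have h4 := sq_mul_gaussian_le ‖η‖
    have h5 := mul_le_mul_of_nonneg_left h3 (Real.exp_pos (-(1 / 4 * ‖η‖ ^ 2))).le
    have h6 := mul_le_mul_of_nonneg_left h4 ht
    simp only
    nlinarith
  rw [integral_const_mul, integral_exp_neg_sq (by norm_num)] at h2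
  calc _ ≤ (4 * Real.pi)⁻¹ * (2 * t * (Real.pi / (1 / 8))) := by gcongr
    _ = 4 * t := by field_simp; ring

lemma integrable_gaussian_mul_rpow {q : ℝ} (hq : -2 < q) :
    Integrable (fun η : ℂ => Real.exp (-(1 / 4 * ‖η‖ ^ 2)) * ‖η‖ ^ q) := by
  have h := Complex.integral_rpow_mul_exp_neg_mul_rpow (p := 2) (q := q) (b := 1 / 4)
    (by norm_num) hq (by norm_num)
  have hpos : (0 : ℝ) < (2 * Real.pi / 2) * (1 / 4 : ℝ) ^ (-(q + 2) / 2) *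
      Real.Gamma ((q + 2) / 2) := by
    have := Real.Gamma_pos_of_pos (s := (q + 2) / 2) (by linarith)
    have := Real.pi_pos
    positivity
  rw [← h] at hpos
  -- A non-integrable function has integral 0 by convention, so a positive value proves
  -- integrability.
  refine (Integrable.of_integral_ne_zero hpos.ne').congr (ae_of_all _ fun η => ?_)
  simp only [Real.rpow_two]
  rw [mul_comm, neg_mul]

/-- Bernoulli gives (1 + x²/d)^d ≥ x², which makes the decay uniform in d. -/
lemma besselZero_pow_le {b : ℝ} (hb : 0 < b)
    (hJ : ∀ r : ℝ, 0 ≤ r → |besselZero r| ≤ (1 + r ^ 2) ^ (-b)) {d : ℕ} (hd : 1 ≤ d) {x : ℝ}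
    (hx : 0 < x) : besselZero (x / √d) ^ d ≤ (x ^ 2) ^ (-b) := by
  have hd0 : (0 : ℝ) < d := by exact_mod_cast hd
  have hr : 0 ≤ x / √d := by positivity
  have hsq : (x / √d) ^ 2 = x ^ 2 / d := by rw [div_pow, Real.sq_sqrt hd0.le]
  have h1 := one_add_mul_le_pow (a := (x / √d) ^ 2) (by linarith [sq_nonneg (x / √d)]) d
  have h2 : x ^ 2 ≤ (1 + (x / √d) ^ 2) ^ d := by
    refine le_trans ?_ h1
    rw [hsq, mul_div_cancel₀ _ hd0.ne']; linarith
  calc besselZero (x / √d) ^ d ≤ |besselZero (x / √d)| ^ d := by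
        rw [← abs_pow]; exact le_abs_self _
    _ ≤ ((1 + (x / √d) ^ 2) ^ (-b)) ^ d := by gcongr; exact hJ _ hr
    _ = ((1 + (x / √d) ^ 2) ^ d) ^ (-b) := by
        exact (Real.rpow_pow_comm (by positivity) _ _)
    _ ≤ (x ^ 2) ^ (-b) :=
        Real.rpow_le_rpow_of_nonpos (by positivity) h2 (by linarith)

lemma exists_laplace_convPow_bounds :
    ∃ C b : ℝ, 0 < b ∧ ∀ d : ℕ, 1 ≤ d → ∀ t : ℝ, 0 < t →
      1 - ∫ z, Real.exp (-(t * (‖z‖ ^ 2 / d))) ∂(convPow etaInfty d) ≤ C * t ∧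
      ∫ z, Real.exp (-(t * (‖z‖ ^ 2 / d))) ∂(convPow etaInfty d) ≤ C * t ^ (-b) := by
  obtain ⟨b, hb, hb1, hJ⟩ := exists_abs_besselZero_le_rpow
  have hp := Real.pi_pos
  set K : ℝ := (4 * Real.pi)⁻¹ * ∫ η : ℂ, Real.exp (-(1 / 4 * ‖η‖ ^ 2)) * ‖η‖ ^ (-(2 * b))
  refine ⟨max 4 K, b, hb, fun d hd t ht => ⟨?_, ?_⟩⟩
  · exact (one_sub_laplace_convPow_le hd ht.le).trans (by gcongr; exact le_max_left _ _)
  have key : ∫ z, Real.exp (-(t * (‖z‖ ^ 2 / d))) ∂(convPow etaInfty d) ≤ K * t ^ (-b) := by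
    have h : ∫ η : ℂ, Real.exp (-(1 / 4 * ‖η‖ ^ 2)) * besselZero (√t * ‖η‖ / √d) ^ d ≤
        ∫ η : ℂ, (Real.exp (-(1 / 4 * ‖η‖ ^ 2)) * ‖η‖ ^ (-(2 * b))) * t ^ (-b) := by
      -- Integrability of |η|^{-2b} at the origin of the plane needs b < 1.
      refine integral_mono_ae (integrable_gaussian_mul_besselZero d _ _)
        ((integrable_gaussian_mul_rpow (by linarith)).mul_const _) ?_
      filter_upwards [Measure.ae_ne volume (0 : ℂ)] with η hη
      have hn : 0 < ‖η‖ := norm_pos_iff.2 hη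
      have h1 := besselZero_pow_le hb hJ hd (mul_pos (Real.sqrt_pos.2 ht) hn)
      rw [mul_pow, Real.sq_sqrt ht.le, Real.mul_rpow ht.le (by positivity), ← Real.rpow_two,
        ← Real.rpow_mul hn.le, mul_neg] at h1
      rw [mul_assoc, mul_comm (‖η‖ ^ _)]
      gcongr
    rw [integral_mul_const] at h
    rw [laplace_convPow ht.le]
    calc _ ≤ (4 * Real.pi)⁻¹ * ((∫ η : ℂ, Real.exp (-(1 / 4 * ‖η‖ ^ 2)) * ‖η‖ ^ (-(2 * b))) *
          t ^ (-b)) := by gcongr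
      _ = _ := by rw [← mul_assoc]
  exact key.trans (by gcongr; exact le_max_right _ _)

lemma tendsto_laplace_convPow {t : ℝ} (ht : 0 < t) :
    Tendsto (fun d : ℕ => ∫ z, Real.exp (-(t * (‖z‖ ^ 2 / d))) ∂(convPow etaInfty d)) atTop
      (𝓝 (1 + t)⁻¹) := by
  have hp := Real.pi_pos
  simp_rw [laplace_convPow ht.le]
  have lim : (1 + t)⁻¹ = (4 * Real.pi)⁻¹ *
      ∫ η : ℂ, Real.exp (-(1 / 4 * ‖η‖ ^ 2)) * Real.exp (-((√t * ‖η‖) ^ 2 / 4)) := by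
    have e : ∀ η : ℂ, Real.exp (-(1 / 4 * ‖η‖ ^ 2)) * Real.exp (-((√t * ‖η‖) ^ 2 / 4)) =
        Real.exp (-((1 + t) / 4 * ‖η‖ ^ 2)) := fun η => by
      rw [← Real.exp_add, mul_pow, Real.sq_sqrt ht.le]; ring_nf
    simp_rw [e]
    rw [integral_exp_neg_sq (by positivity)]
    field_simp
  rw [lim]
  refine Tendsto.const_mul _ ?_
  refine tendsto_integral_of_dominated_convergence _
    (fun d => (integrable_gaussian_mul_besselZero d _ _).aestronglyMeasurable)
    (integrable_exp_neg_mul_sq_norm (by norm_num : (0 : ℝ) < 1 / 4)) (fun d => ?_) ?_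
  · refine ae_of_all _ fun η => ?_
    rw [norm_mul, norm_pow, Real.norm_of_nonneg (Real.exp_pos _).le]
    exact mul_le_of_le_one_right (Real.exp_pos _).le
      (pow_le_one₀ (norm_nonneg _) (abs_besselZero_le_one _))
  · exact ae_of_all _ fun η => (tendsto_besselZero_pow _).const_mul _

/-! ### Conclusion by dominated convergence -/

lemma log_norm_eq {d : ℕ} (hd : 1 ≤ d) {z : ℂ} (hz : 0 < ‖z‖ ^ 2 / d) :
    Real.log ‖z‖ = Real.log (‖z‖ ^ 2 / d) / 2 + Real.log d / 2 := by
  have hd0 : (d : ℝ) ≠ 0 := by positivity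
  have : ‖z‖ ^ 2 ≠ 0 := fun h => by simp [h] at hz
  rw [Real.log_div this hd0, Real.log_pow]
  push_cast; ring

lemma integrable_log_and_cInfty_eq {C b : ℝ} (hb : 0 < b) {d : ℕ} (hd : 1 ≤ d)
    (h : ∀ t : ℝ, 0 < t →
      1 - ∫ z, Real.exp (-(t * (‖z‖ ^ 2 / d))) ∂(convPow etaInfty d) ≤ C * t ∧
      ∫ z, Real.exp (-(t * (‖z‖ ^ 2 / d))) ∂(convPow etaInfty d) ≤ C * t ^ (-b)) :
    Integrable (fun z : ℂ => Real.log ‖z‖) (convPow etaInfty d) ∧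
      cInfty d - Real.log d / 2 = (∫ t in Set.Ioi (0 : ℝ), t⁻¹ * (Real.exp (-t) -
        ∫ z, Real.exp (-(t * (‖z‖ ^ 2 / d))) ∂(convPow etaInfty d))) / 2 := by
  have hm : Measurable fun z : ℂ => ‖z‖ ^ 2 / (d : ℝ) := by fun_prop
  have h0 : ∀ z : ℂ, 0 ≤ ‖z‖ ^ 2 / (d : ℝ) := fun z => by positivity
  obtain ⟨hi, he⟩ := integrable_log_and_integral_log_eq_frullani (μ := convPow etaInfty d) hm h0 hb
    (fun t ht => (h t ht).1) (fun t ht => (h t ht).2)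
  have hae : (fun z : ℂ => Real.log ‖z‖) =ᵐ[convPow etaInfty d]
      fun z => Real.log (‖z‖ ^ 2 / d) / 2 + Real.log d / 2 := by
    -- The point z = 0, where the convention log 0 = 0 can break the identity, is a null set.
    filter_upwards [ae_pos_of_laplace_le hm h0 hb fun t ht => (h t ht).2] with z hz
    exact log_norm_eq hd hz
  refine ⟨((hi.div_const 2).add (integrable_const _)).congr hae.symm, ?_⟩
  rw [cInfty, integral_congr_ae hae, integral_add (hi.div_const 2) (integrable_const _),
    integral_div, he]
  simp

theorem proposition6p1 :
    (∀ d : ℕ, 1 ≤ d → Integrable (fun z : ℂ => Real.log ‖z‖) (convPow etaInfty d)) ∧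
      Tendsto (fun d : ℕ => cInfty d - Real.log (d : ℝ) / 2) atTop
        (𝓝 (-Real.eulerMascheroniConstant / 2)) := by
  obtain ⟨C, b, hb, h⟩ := exists_laplace_convPow_bounds
  refine ⟨fun d hd => (integrable_log_and_cInfty_eq hb hd (h d hd)).1, ?_⟩
  have hev : (fun d : ℕ => (∫ t in Set.Ioi (0 : ℝ), t⁻¹ * (Real.exp (-t) -
      ∫ z, Real.exp (-(t * (‖z‖ ^ 2 / d))) ∂(convPow etaInfty d))) / 2) =ᶠ[atTop]
      fun d : ℕ => cInfty d - Real.log (d : ℝ) / 2 := by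
    filter_upwards [eventually_ge_atTop 1] with d hd
    exact (integrable_log_and_cInfty_eq hb hd (h d hd)).2.symm
  refine Tendsto.congr' hev (Tendsto.div_const ?_ 2)
  rw [← integral_frullani_inv_one_add]
  refine tendsto_integral_filter_of_dominated_convergence (frullaniBound C b) ?_ ?_
    (integrable_frullaniBound C hb).integrableOn ?_
  · refine Eventually.of_forall fun d => Measurable.aestronglyMeasurable ?_
    have : Measurable fun t : ℝ =>
        ∫ z, Real.exp (-(t * (‖z‖ ^ 2 / d))) ∂(convPow etaInfty d) :=
      (StronglyMeasurable.integral_prod_right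
        (f := fun (t : ℝ) (z : ℂ) => Real.exp (-(t * (‖z‖ ^ 2 / d))))
        (Measurable.stronglyMeasurable (by fun_prop))).measurable
    fun_prop
  · filter_upwards [eventually_ge_atTop 1] with d hd
    filter_upwards [ae_restrict_mem measurableSet_Ioi] with t ht
    have ht : 0 < t := ht
    refine norm_inv_mul_exp_sub_le ht (h d hd t ht).1 (h d hd t ht).2
      (integral_nonneg fun _ => (Real.exp_pos _).le) ?_
    have := integral_mono (μ := convPow etaInfty d)
      (integrable_exp_neg_mul (X := fun z : ℂ => ‖z‖ ^ 2 / (d : ℝ)) (by fun_prop)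
        (fun z => by positivity) ht.le)
      (integrable_const 1) (fun z => Real.exp_le_one_iff.2 (by
        have : 0 ≤ t * (‖z‖ ^ 2 / (d : ℝ)) := by positivity
        linarith))
    simpa using this
  · filter_upwards [ae_restrict_mem measurableSet_Ioi] with t ht
    exact ((tendsto_const_nhds).sub (tendsto_laplace_convPow ht)).const_mul _
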